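/- For $R>1$ let $T_R=\{((R+\cos v)\cos u,(R+\cos v)\sin u,\sin v): u,v\in[0,2\pi]\}\subset\mathbb R^3$, and for $p\in\mathbb R^3$ let $i_p$ be the inversion in the unit sphere centred at $p$. Call two subsets of $\mathbb R^3$ homothetic if a similarity of $\mathbb R^3$ maps one onto the other. For $\varrho>0$ let $\mathcal C(\varrho;R)$ be the (possibly degenerate) circle in the $(\rho,z)$-plane with diameter from $(\varrho,0)$ to $((R^2-1)/\varrho,0)$, let $\mathcal C(0;R)$ be the $z$-axis, and let $\mathcal T(\varrho;R)=\{(\rho\cos\theta,\rho\sin\theta,z):(\rho,z)\in\mathcal C(\varrho;R),\ \theta\in[0,2\pi]\}$. Put $$C_R=\begin{cases}[0,\sqrt{R^2-1}]\setminus\{R-1\}, & R\in(1,\sqrt2),\\ [0,\sqrt2-1), & R=\sqrt2,\end{cases}\qquad C=\bigcup_{R\in(1,\sqrt2]}\{(R,\varrho):\varrho\in C_R\}.$$ Theorem. For $(R,\varrho)\in C$ the set $\mathcal T(\varrho;R)$ is disjoint from $T_R$ and all the surfaces $i_p(T_R)$ with $p\in\mathcal T(\varrho;R)$ are homothetic to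 one another; write $i_\varrho(T_R)$ for their common homothety class (it is the class of $i_{(\varrho,0,0)}(T_R)$). Distinct elements $(R,\varrho)$ of $C$ give distinct classes $i_\varrho(T_R)$, and $(R,\varrho)\mapsto i_\varrho(T_R)$ is a bijection from $C$ onto the shape space $$\{\,i_p(T_R): R>1,\ p\in\mathbb R^3\setminus T_R\,\}\,/\,\text{homothety}.$$ -/

import Mathlib

open Set

noncomputable section

/-- Euclidean 3-space. -/
abbrev E3 := EuclideanSpace ℝ (Fin 3)

/-- The torus of revolution `T_R` about the `z`-axis, with major radius `R` and minor radius `1`. -/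
def roundTorus (R : ℝ) : Set E3 :=
  {x | ∃ u ∈ Icc (0 : ℝ) (2 * Real.pi), ∃ v ∈ Icc (0 : ℝ) (2 * Real.pi),
    x = !₂[(R + Real.cos v) * Real.cos u, (R + Real.cos v) * Real.sin u, Real.sin v]}

/-- The image of `T_R` under the inversion in the unit sphere centred at `p`. -/
def invertedTorus (R : ℝ) (p : E3) : Set E3 :=
  EuclideanGeometry.inversion p 1 '' roundTorus R

/-- Two point sets have the same Euclidean shape when a similarity of 3-space (a bijection that
multiplies all distances by one positive factor) carries one onto the other. -/
def Homothetic (S S' : Set E3) : Prop := ∃ h : E3 ≃ᵈ E3, h '' S = S'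

/-- Being homothetic is an equivalence relation. -/
def homothetySetoid : Setoid (Set E3) where
  r := Homothetic
  iseqv :=
    { refl := fun S => ⟨DilationEquiv.refl E3, by simp⟩
      symm := by
        rintro S _ ⟨h, rfl⟩
        exact ⟨h.symm, by simp [image_image]⟩
      trans := by
        rintro S _ _ ⟨h, rfl⟩ ⟨k, rfl⟩
        exact ⟨h.trans k, by simp [image_image]⟩ }

/-- Euclidean shapes: point sets up to homothety. -/
def Shape : Type := Quotient homothetySetoid

/-- The Euclidean shape of a point set. -/
def shapeOf (S : Set E3) : Shape := Quotient.mk homothetySetoid S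

/-- The shape space of all inverted tori: all the `i_p(T_R)` with `R > 1` and `p` off `T_R`,
up to homothety. -/
def shapeSpace : Set Shape :=
  {s | ∃ R : ℝ, 1 < R ∧ ∃ p : E3, p ∉ roundTorus R ∧ s = shapeOf (invertedTorus R p)}

/-- The circle in the `(ρ, z)`-plane with diameter from `(ϱ, 0)` to `((R² - 1) / ϱ, 0)`;
for `ϱ = 0` it is by convention the `z`-axis. -/
def profileCircle (R ϱ : ℝ) : Set (ℝ × ℝ) :=
  {q | (ϱ = 0 ∧ q.1 = 0) ∨
    (ϱ ≠ 0 ∧ (q.1 - (ϱ + (R ^ 2 - 1) / ϱ) / 2) ^ 2 + q.2 ^ 2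
      = ((ϱ - (R ^ 2 - 1) / ϱ) / 2) ^ 2)}

/-- The surface of revolution about the `z`-axis generated by `profileCircle R ϱ`. -/
def profileTorus (R ϱ : ℝ) : Set E3 :=
  {x | ∃ q ∈ profileCircle R ϱ, ∃ θ ∈ Icc (0 : ℝ) (2 * Real.pi),
    x = !₂[q.1 * Real.cos θ, q.1 * Real.sin θ, q.2]}

/-- The shape `i_ϱ(T_R)`, represented by the inversion centred at `(ϱ, 0, 0)`, a point of
`profileTorus R ϱ`. -/
def inversionShape (R ϱ : ℝ) : Shape := shapeOf (invertedTorus R !₂[ϱ, 0, 0])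

/-- The parameter set `C_R`, for `1 < R ≤ √2`. -/
def paramFiber (R : ℝ) : Set ℝ :=
  {ϱ | (R < √2 ∧ ϱ ∈ Icc 0 (√(R ^ 2 - 1)) \ {R - 1}) ∨ (R = √2 ∧ ϱ ∈ Ico 0 (√2 - 1))}

/-- The parameter set `C`, the union of `{R} × C_R` over `R ∈ (1, √2]`. -/
def paramSet : Set (ℝ × ℝ) := ⋃ R ∈ Ioc 1 √2, {R} ×ˢ paramFiber R

end

noncomputable section

/-! The torus is invariant under reflections in planes through its axis and under inversions in
spheres centred on the axis and orthogonal to it. Moving `p` by such a map changes `i_p(T_R)` only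
by a similarity, and these maps carry any point of `profileTorus R d` to `(d, 0, 0)`. As the
surfaces with `0 ≤ d` and `d ^ 2 ≤ R ^ 2 - 1` cover space, only the centres `(d, 0, 0)` matter.

For such a centre the image is similar to a cyclide `dupinCyclide r q` with `NestedCircles r q`, and
`eq_of_homothetic_dupinCyclide` shows that `(r, q)` is a complete similarity invariant of these
normal forms. The quantity `((1 + r) ^ 2 - q ^ 2) / (4 * r)` equals `R ^ 2 / (R ^ 2 - 1)` for a
centre outside the solid torus and `R ^ 2` for one inside (`exists_normalForm`). Given `R` and the
side, `r` then determines `d`.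

So inside centres for `R` and outside centres for `S` give the same shapes exactly when `1 / R ^ 2 +
1 / S ^ 2 = 1`. This duality exchanges `R < √2` with `R > √2` and fixes `√2`. Hence `R < √2` with
both sides, together with one side at `R = √2`, represents each shape once. -/

lemma norm_sq_eq_coords (x : E3) : ‖x‖ ^ 2 = x 0 ^ 2 + x 1 ^ 2 + x 2 ^ 2 := by
  simp [EuclideanSpace.norm_sq_eq, Fin.sum_univ_three]

/-! ### Similarity invariants of the normal form -/

/-- The Dupin cyclide whose plane section `z = 0` consists of the unit circle centred at the
origin and of the circle of radius `r` centred at `(q, 0, 0)`. -/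
def dupinCyclide (r q : ℝ) : Set E3 :=
  {x | (‖x‖ ^ 2 - 1) * (‖x‖ ^ 2 - 2 * q * x 0 + q ^ 2 - r ^ 2)
    + ((1 + r) ^ 2 - q ^ 2) * x 2 ^ 2 = 0}

lemma mem_dupinCyclide {r q : ℝ} {x : E3} : x ∈ dupinCyclide r q ↔
    (‖x‖ ^ 2 - 1) * (‖x‖ ^ 2 - 2 * q * x 0 + q ^ 2 - r ^ 2)
      + ((1 + r) ^ 2 - q ^ 2) * x 2 ^ 2 = 0 := Iff.rfl

/-- The inner circle has positive radius, lies strictly inside the unit circle, and its centre is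
on the nonnegative half-axis. -/
def NestedCircles (r q : ℝ) : Prop := 0 < r ∧ 0 ≤ q ∧ r + q < 1

lemma abs_coord_le_norm (x : E3) (i : Fin 3) : |x i| ≤ ‖x‖ := by
  simpa using PiLp.norm_apply_le x i

/-- Outside the closed unit ball both factors of the product are positive and the remaining term is
nonnegative, so the quartic cannot vanish. -/
lemma norm_le_one_of_mem_dupinCyclide {r q : ℝ} (h : NestedCircles r q) {x : E3}
    (hx : x ∈ dupinCyclide r q) : ‖x‖ ≤ 1 := by
  obtain ⟨hr, hq, hrq⟩ := h
  by_contra! hn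
  have h0 : x 0 ≤ ‖x‖ := (le_abs_self _).trans (abs_coord_le_norm x 0)
  have h1 : 0 < ‖x‖ ^ 2 - 2 * q * x 0 + q ^ 2 - r ^ 2 := by
    have : 2 * q * x 0 ≤ 2 * q * ‖x‖ := by gcongr
    nlinarith
  have h2 : 0 < ‖x‖ ^ 2 - 1 := by nlinarith
  have h3 : 0 ≤ ((1 + r) ^ 2 - q ^ 2) * x 2 ^ 2 := by
    apply mul_nonneg _ (sq_nonneg _)
    nlinarith
  have := mul_pos h2 h1
  rw [mem_dupinCyclide] at hx
  linarith

lemma coord_two_eq_zero_of_mem_dupinCyclide {r q : ℝ} (h : NestedCircles r q) {x : E3}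
    (hx : x ∈ dupinCyclide r q) (hn : ‖x‖ = 1) : x 2 = 0 := by
  obtain ⟨hr, hq, hrq⟩ := h
  rw [mem_dupinCyclide, hn] at hx
  have : (1 + r) ^ 2 - q ^ 2 ≠ 0 := by nlinarith
  simpa [this] using hx

/-- The first standard basis vector. -/
abbrev axisVector : E3 := !₂[1, 0, 0]

lemma norm_axisVector : ‖axisVector‖ = 1 := by
  simp [EuclideanSpace.norm_eq, Fin.sum_univ_three]

lemma smul_axisVector_mem_dupinCyclide {r q t : ℝ} :
    t • axisVector ∈ dupinCyclide r q ↔ (t ^ 2 - 1) * ((t - q) ^ 2 - r ^ 2) = 0 := by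
  rw [mem_dupinCyclide, norm_smul, norm_axisVector]
  have h0 : (t • axisVector) 0 = t := by simp
  have h2 : (t • axisVector) 2 = 0 := by simp
  rw [h0, h2, Real.norm_eq_abs, mul_one, sq_abs]
  refine Eq.congr ?_ rfl
  ring

/-- Two points of the source at distance 2, namely `±axisVector`, land in the closed unit ball,
whose diameter is 2. -/
lemma ratio_le_one_of_image_dupinCyclide {r q r' q' : ℝ} (h' : NestedCircles r' q') (f : E3 ≃ᵈ E3)
    (hf : f '' dupinCyclide r q = dupinCyclide r' q') : (Dilation.ratio f : ℝ) ≤ 1 := by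
  have key : ∀ t : ℝ, t ^ 2 = 1 → ‖f (t • axisVector)‖ ≤ 1 := fun t ht =>
    norm_le_one_of_mem_dupinCyclide h' <| hf ▸ mem_image_of_mem f
      (smul_axisVector_mem_dupinCyclide.2 (by rw [ht]; ring))
  have h1 := key 1 (by norm_num)
  have h2 := key (-1) (by norm_num)
  have h3 := Dilation.dist_eq f ((1 : ℝ) • axisVector) ((-1 : ℝ) • axisVector)
  have h4 : dist ((1 : ℝ) • axisVector) ((-1 : ℝ) • axisVector) = 2 := by
    rw [dist_eq_norm, ← sub_smul, norm_smul, norm_axisVector]; norm_num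
  rw [h4, dist_eq_norm] at h3
  have := norm_sub_le (f ((1 : ℝ) • axisVector)) (f ((-1 : ℝ) • axisVector))
  linarith

/-- An isometry sends `±axisVector` to a diameter of the unit ball, hence is linear, and the image
`u` of `axisVector` lies on the unit circle in the plane `z = 0`. The points at parameters `q ± r`
then go to the inner circle, so `q ± r` are the two roots of one quadratic in `t`. Its root sum and
product give the two conclusions; applying the first to the inverse isometry as well yields equality
of the centres. -/
lemma center_le_of_image_dupinCyclide {r q r' q' : ℝ} (h : NestedCircles r q)
    (h' : NestedCircles r' q') (f : E3 ≃ᵢ E3)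
    (hf : f '' dupinCyclide r q = dupinCyclide r' q') :
    q ≤ q' ∧ q ^ 2 - r ^ 2 = q' ^ 2 - r' ^ 2 := by
  have mem : ∀ {t : ℝ}, (t ^ 2 - 1) * ((t - q) ^ 2 - r ^ 2) = 0 →
      f (t • axisVector) ∈ dupinCyclide r' q' := fun ht =>
    hf ▸ mem_image_of_mem f (smul_axisVector_mem_dupinCyclide.2 ht)
  have hf0 : f 0 = 0 := by
    have h1 := norm_le_one_of_mem_dupinCyclide h' (mem (t := 1) (by norm_num))
    have h2 := norm_le_one_of_mem_dupinCyclide h' (mem (t := -1) (by norm_num))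
    have h3 := f.dist_eq ((1 : ℝ) • axisVector) ((-1 : ℝ) • axisVector)
    have h4 : dist ((1 : ℝ) • axisVector) ((-1 : ℝ) • axisVector) = 2 := by
      rw [dist_eq_norm, ← sub_smul, norm_smul, norm_axisVector]; norm_num
    rw [h4, dist_eq_norm] at h3
    have h5 := f.map_midpoint ((1 : ℝ) • axisVector) ((-1 : ℝ) • axisVector)
    have h6 : midpoint ℝ ((1 : ℝ) • axisVector) ((-1 : ℝ) • axisVector) = 0 := by
      rw [midpoint_eq_smul_add, ← add_smul]; simp
    rw [h6, midpoint_eq_smul_add] at h5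
    set a := f ((1 : ℝ) • axisVector)
    set b := f ((-1 : ℝ) • axisVector)
    -- Two vectors of norm at most 1 at distance 2 have sum zero.
    have h7 := parallelogram_law_with_norm ℝ a b
    have h8 : ‖a + b‖ = 0 := by
      have := norm_nonneg (a + b)
      have := norm_nonneg a
      have := norm_nonneg b
      nlinarith
    rw [h5, norm_eq_zero.1 h8, smul_zero]
  set L := f.toRealLinearIsometryEquivOfMapZero hf0 with hL
  have hLf : ∀ x, f x = L x := fun x => rfl
  set u := L axisVector with hu
  have hun : ‖u‖ = 1 := by rw [hu, L.norm_map, norm_axisVector]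
  have hu2 : u 2 = 0 := by
    refine coord_two_eq_zero_of_mem_dupinCyclide h' ?_ hun
    have := mem (t := 1) (by norm_num)
    rwa [one_smul] at this
  have inner : ∀ t : ℝ, |t| < 1 → (t - q) ^ 2 = r ^ 2 →
      t ^ 2 - 2 * q' * (t * u 0) + q' ^ 2 - r' ^ 2 = 0 := by
    intro t ht htq
    have hm := mem (t := t) (by rw [htq]; ring)
    rw [hLf, L.map_smul, ← hu, mem_dupinCyclide, norm_smul, hun] at hm
    simp only [PiLp.smul_apply, smul_eq_mul, Real.norm_eq_abs, mul_one, sq_abs, hu2, mul_zero]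
      at hm
    have h1 : t ^ 2 - 1 ≠ 0 := by
      have := (sq_lt_one_iff_abs_lt_one t).2 ht
      linarith
    simpa [h1] using hm
  obtain ⟨hr, hq, hrq⟩ := h
  have e1 := inner (q + r) (abs_lt.2 ⟨by linarith, by linarith⟩) (by ring)
  have e2 := inner (q - r) (abs_lt.2 ⟨by linarith, by linarith⟩) (by ring)
  have e3 : q = q' * u 0 := by
    have : r * (q - q' * u 0) = 0 := by linarith
    rcases mul_eq_zero.1 this with h | h <;> linarith
  have hu0 : u 0 ≤ 1 := hun ▸ (le_abs_self _).trans (abs_coord_le_norm u 0)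
  refine ⟨?_, ?_⟩
  · rw [e3]; exact mul_le_of_le_one_right h'.2.1 hu0
  · linear_combination (-1 / 2 : ℝ) * (e1 + e2) + 2 * q * e3

lemma Homothetic.symm {S T : Set E3} (h : Homothetic S T) : Homothetic T S :=
  homothetySetoid.symm h

lemma Homothetic.trans {S T U : Set E3} (h : Homothetic S T) (h' : Homothetic T U) :
    Homothetic S U :=
  homothetySetoid.trans h h'

/-- The radius and the centre of the inner circle are similarity invariants. -/
theorem eq_of_homothetic_dupinCyclide {r q r' q' : ℝ} (h : NestedCircles r q)
    (h' : NestedCircles r' q') (hh : Homothetic (dupinCyclide r q) (dupinCyclide r' q')) :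
    r = r' ∧ q = q' := by
  obtain ⟨f, hf⟩ := hh
  have hf' : f.symm '' dupinCyclide r' q' = dupinCyclide r q := by
    rw [← hf]; simp [image_image]
  have h1 := ratio_le_one_of_image_dupinCyclide h' f hf
  have h2 := ratio_le_one_of_image_dupinCyclide h f.symm hf'
  have hpos : (0 : ℝ) < Dilation.ratio f := by exact_mod_cast Dilation.ratio_pos f
  have hone : (Dilation.ratio f : ℝ) = 1 := by
    rw [DilationEquiv.ratio_symm, NNReal.coe_inv] at h2
    exact le_antisymm h1 ((inv_le_one₀ hpos).1 h2)
  let g : E3 ≃ᵢ E3 := ⟨f.toEquiv, Isometry.of_dist_eq fun x y => by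
    have := Dilation.dist_eq f x y
    rwa [hone, one_mul] at this⟩
  have hg : g '' dupinCyclide r q = dupinCyclide r' q' := hf
  have hg' : g.symm '' dupinCyclide r' q' = dupinCyclide r q := hf'
  obtain ⟨a, b⟩ := center_le_of_image_dupinCyclide h h' g hg
  obtain ⟨c, -⟩ := center_le_of_image_dupinCyclide h' h g.symm hg'
  have hqq := le_antisymm a c
  subst hqq
  exact ⟨(pow_left_inj₀ h.1.le h'.1.le two_ne_zero).1 (by linarith), rfl⟩

/-! ### Similarities and changes of the inversion centre -/

/-- The dilation `x ↦ a + t • L x`. -/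
def affineDilation (L : E3 ≃ₗᵢ[ℝ] E3) (a : E3) {t : ℝ} (ht : t ≠ 0) : E3 ≃ᵈ E3 where
  toFun x := a + t • L x
  invFun y := L.symm (t⁻¹ • (y - a))
  left_inv x := by simp [smul_smul, ht]
  right_inv y := by simp [smul_smul, ht]
  edist_eq' := by
    refine ⟨‖t‖₊, by simpa using ht, fun x y => ?_⟩
    rw [edist_add_left, edist_smul₀, L.edist_map]
    rfl

lemma homothetic_of_mem_iff {S T : Set E3} (L : E3 ≃ₗᵢ[ℝ] E3) (a : E3) {t : ℝ} (ht : t ≠ 0)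
    (h : ∀ x, x ∈ S ↔ a + t • L x ∈ T) : Homothetic S T := by
  refine ⟨affineDilation L a ht, ?_⟩
  ext y
  constructor
  · rintro ⟨x, hx, rfl⟩
    exact (h x).1 hx
  · intro hy
    obtain ⟨x, rfl⟩ := (affineDilation L a ht).surjective y
    exact ⟨x, (h x).2 hy, rfl⟩

lemma homothetic_image {S : Set E3} (L : E3 ≃ₗᵢ[ℝ] E3) (a : E3) {t : ℝ} (ht : t ≠ 0) :
    Homothetic S ((fun x => a + t • L x) '' S) := ⟨affineDilation L a ht, rfl⟩

lemma inversion_one_eq (p x : E3) :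
    EuclideanGeometry.inversion p 1 x = (‖x - p‖ ^ 2)⁻¹ • (x - p) + p := by
  simp [EuclideanGeometry.inversion, dist_eq_norm]

/-- Inverting at `p` or at the image of `p` under an isometry fixing the surface gives the same
shape. -/
lemma homothetic_inversion_map {S : Set E3} (L : E3 ≃ₗᵢ[ℝ] E3) (p : E3) (hS : L '' S = S) :
    Homothetic (EuclideanGeometry.inversion p 1 '' S)
      (EuclideanGeometry.inversion (L p) 1 '' S) := by
  have := homothetic_image (S := EuclideanGeometry.inversion p 1 '' S) L 0 one_ne_zero
  convert this using 1
  conv_lhs => rw [← hS]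
  rw [image_image, image_image]
  refine image_congr fun x _ => ?_
  rw [inversion_one_eq, inversion_one_eq, ← map_sub, L.norm_map]
  simp

/-- With `J` the inversion at `c`, the composite of `i_p`, `J` and `i_{J p}` fixes infinity, so it
is a similarity; its linear part is a multiple of the reflection in the hyperplane orthogonal to `p
- c`. -/
lemma inversion_inversion_eq {c p x : E3} {k : ℝ} (hk : k ≠ 0) (hp : p ≠ c) (hx : x ≠ c)
    (hxp : x ≠ p) :
    EuclideanGeometry.inversion (EuclideanGeometry.inversion c k p) 1
      (EuclideanGeometry.inversion c k x) =
    EuclideanGeometry.inversion c k p + (‖p - c‖ ^ 2 / k ^ 2) •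
      ((ℝ ∙ (p - c))ᗮ.reflection (EuclideanGeometry.inversion p 1 x - p)
        - (‖p - c‖ ^ 2)⁻¹ • (p - c)) := by
  have hd := EuclideanGeometry.dist_inversion_inversion hx hp k
  rw [inversion_one_eq, inversion_one_eq, ← dist_eq_norm, hd]
  obtain ⟨u, rfl⟩ : ∃ u, p = c + u := ⟨p - c, by abel⟩
  obtain ⟨w, rfl⟩ : ∃ w, x = c + u + w := ⟨x - (c + u), by abel⟩
  have hu : ‖u‖ ≠ 0 := by simpa using hp
  have hw : ‖w‖ ≠ 0 := by simpa using hxp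
  have huw : ‖u + w‖ ≠ 0 := by
    intro h
    apply hx
    rw [add_assoc, norm_eq_zero.1 h, add_zero]
  have hD := norm_add_sq_real u w
  have e1 : c + u + w - c = u + w := by abel
  simp only [EuclideanGeometry.inversion, dist_eq_norm, vsub_eq_sub, vadd_eq_add, e1,
    add_sub_cancel_left, add_sub_cancel_right, map_smul,
    Submodule.reflection_orthogonal_apply, Submodule.reflection_singleton_apply,
    RCLike.ofReal_real_eq_id, id_eq]
  match_scalars
  · field_simp
    linear_combination (-‖u‖ ^ 2) * hD
  · field_simp
  · ring

/-- Conjugating by an inversion that preserves the surface does not change the shape. -/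
lemma homothetic_inversion_inversion {S : Set E3} {c p : E3} {k : ℝ} (hk : k ≠ 0) (hp : p ≠ c)
    (hc : c ∉ S) (hpS : p ∉ S) (hS : EuclideanGeometry.inversion c k '' S = S) :
    Homothetic (EuclideanGeometry.inversion p 1 '' S)
      (EuclideanGeometry.inversion (EuclideanGeometry.inversion c k p) 1 '' S) := by
  have ht : ‖p - c‖ ^ 2 / k ^ 2 ≠ 0 := by
    have := sub_ne_zero.2 hp
    positivity
  have := homothetic_image (S := EuclideanGeometry.inversion p 1 '' S)
    (ℝ ∙ (p - c))ᗮ.reflection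
    (EuclideanGeometry.inversion c k p - (‖p - c‖ ^ 2 / k ^ 2) •
      ((ℝ ∙ (p - c))ᗮ.reflection p + (‖p - c‖ ^ 2)⁻¹ • (p - c))) ht
  convert this using 1
  conv_lhs => rw [← hS]
  rw [image_image, image_image]
  refine image_congr fun x hx => ?_
  rw [inversion_inversion_eq hk hp (ne_of_mem_of_not_mem hx hc) (ne_of_mem_of_not_mem hx hpS),
    map_sub]
  module

/-! ### The torus and its conformal symmetries -/

lemma exists_polar (a b : ℝ) : ∃ u ∈ Icc (0 : ℝ) (2 * Real.pi),
    a = √(a ^ 2 + b ^ 2) * Real.cos u ∧ b = √(a ^ 2 + b ^ 2) * Real.sin u := by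
  have hn : √(a ^ 2 + b ^ 2) = ‖(⟨a, b⟩ : ℂ)‖ := by
    rw [Complex.norm_def, Complex.normSq_apply, sq, sq]
  have h1 := Complex.norm_mul_cos_arg ⟨a, b⟩
  have h2 := Complex.norm_mul_sin_arg ⟨a, b⟩
  have h3 := Complex.arg_le_pi ⟨a, b⟩
  have h4 := Complex.neg_pi_lt_arg ⟨a, b⟩
  have := Real.pi_pos
  rw [hn]
  rcases le_total 0 (Complex.arg ⟨a, b⟩) with h | h
  · exact ⟨_, ⟨h, by linarith⟩, h1.symm, h2.symm⟩
  · refine ⟨Complex.arg ⟨a, b⟩ + 2 * Real.pi, ⟨by linarith, by linarith⟩, ?_, ?_⟩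
    · rw [Real.cos_add_two_pi]; exact h1.symm
    · rw [Real.sin_add_two_pi]; exact h2.symm

lemma ext_coords {x y : E3} (h0 : x 0 = y 0) (h1 : x 1 = y 1) (h2 : x 2 = y 2) : x = y := by
  ext i
  fin_cases i
  · exact h0
  · exact h1
  · exact h2

/-- The implicit equation of the torus. -/
lemma mem_roundTorus_iff {R : ℝ} (hR : 1 < R) {x : E3} : x ∈ roundTorus R ↔
    (‖x‖ ^ 2 + (R ^ 2 - 1)) ^ 2 = 4 * R ^ 2 * (x 0 ^ 2 + x 1 ^ 2) := by
  rw [norm_sq_eq_coords]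
  constructor
  · rintro ⟨u, -, v, -, rfl⟩
    simp only [Matrix.cons_val_zero, Matrix.cons_val_one, Matrix.cons_val]
    have hu := Real.sin_sq_add_cos_sq u
    have hv := Real.sin_sq_add_cos_sq v
    have e1 : ((R + Real.cos v) * Real.cos u) ^ 2 + ((R + Real.cos v) * Real.sin u) ^ 2
        = (R + Real.cos v) ^ 2 := by linear_combination (R + Real.cos v) ^ 2 * hu
    have e2 : (R + Real.cos v) ^ 2 + Real.sin v ^ 2 + (R ^ 2 - 1) = 2 * R * (R + Real.cos v) := by
      linear_combination hv
    rw [e1, e2]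
    ring
  · intro h
    obtain ⟨u, hu, hu0, hu1⟩ := exists_polar (x 0) (x 1)
    set ρ := √(x 0 ^ 2 + x 1 ^ 2) with hρ
    have hρ2 : ρ ^ 2 = x 0 ^ 2 + x 1 ^ 2 := Real.sq_sqrt (by positivity)
    have hρ0 : 0 ≤ ρ := Real.sqrt_nonneg _
    have hb : 0 < R ^ 2 - 1 := by nlinarith
    -- Since `R > 1`, both sides are nonnegative and the square root of the quartic has only this
    -- branch.
    have h1 : ρ ^ 2 + x 2 ^ 2 + (R ^ 2 - 1) = 2 * R * ρ := by
      rw [← pow_left_inj₀ (by positivity) (by positivity) two_ne_zero, hρ2, h, mul_pow, hρ2]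
      ring
    have h2 : (ρ - R) ^ 2 + x 2 ^ 2 = 1 := by linear_combination h1
    obtain ⟨v, hv, hv0, hv1⟩ := exists_polar (ρ - R) (x 2)
    rw [h2, Real.sqrt_one, one_mul] at hv0 hv1
    refine ⟨u, hu, v, hv, ext_coords ?_ ?_ ?_⟩
    · simp [← hv0, ← hu0]
    · simp [← hv0, ← hu1]
    · simp [← hv1]

/-- The reflection in the vertical plane that exchanges the `x`-axis and the half-line at
angle `θ`. -/
def verticalReflection (θ : ℝ) : E3 ≃ₗᵢ[ℝ] E3 where
  toLinearEquiv := LinearEquiv.ofInvolutive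
    { toFun := fun x => !₂[Real.cos θ * x 0 + Real.sin θ * x 1,
        Real.sin θ * x 0 - Real.cos θ * x 1, x 2]
      map_add' := fun x y => by apply ext_coords <;> simp <;> ring
      map_smul' := fun t x => by apply ext_coords <;> simp <;> ring }
    (fun x => by
      have h := Real.sin_sq_add_cos_sq θ
      apply ext_coords
      · simp; linear_combination x 0 * h
      · simp; linear_combination x 1 * h
      · simp)
  norm_map' := fun x => by
    have h := Real.sin_sq_add_cos_sq θ
    rw [← pow_left_inj₀ (norm_nonneg _) (norm_nonneg _) two_ne_zero, norm_sq_eq_coords,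
      norm_sq_eq_coords]
    change (Real.cos θ * x 0 + Real.sin θ * x 1) ^ 2 + (Real.sin θ * x 0 - Real.cos θ * x 1) ^ 2
      + x 2 ^ 2 = _
    linear_combination (x 0 ^ 2 + x 1 ^ 2) * h

lemma verticalReflection_apply (θ : ℝ) (x : E3) : verticalReflection θ x =
    !₂[Real.cos θ * x 0 + Real.sin θ * x 1, Real.sin θ * x 0 - Real.cos θ * x 1, x 2] := rfl

lemma verticalReflection_verticalReflection (θ : ℝ) (x : E3) :
    verticalReflection θ (verticalReflection θ x) = x :=
  (verticalReflection θ).toLinearEquiv.left_inv x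

lemma image_eq_of_involutive {α : Type*} {f : α → α} {S : Set α} (hf : Function.Involutive f)
    (h : ∀ x ∈ S, f x ∈ S) : f '' S = S :=
  Subset.antisymm (image_subset_iff.2 h) fun x hx => ⟨f x, h x hx, hf x⟩

lemma verticalReflection_image_roundTorus {R : ℝ} (hR : 1 < R) (θ : ℝ) :
    verticalReflection θ '' roundTorus R = roundTorus R := by
  refine image_eq_of_involutive (verticalReflection_verticalReflection θ) fun x hx => ?_
  rw [mem_roundTorus_iff hR] at hx ⊢
  rw [LinearIsometryEquiv.norm_map, hx]
  have h := Real.sin_sq_add_cos_sq θ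
  simp only [verticalReflection_apply, Matrix.cons_val_zero, Matrix.cons_val_one]
  linear_combination (-4 * R ^ 2 * (x 0 ^ 2 + x 1 ^ 2)) * h

lemma axis_notMem_roundTorus {R : ℝ} (hR : 1 < R) (s : ℝ) : !₂[0, 0, s] ∉ roundTorus R := by
  rw [mem_roundTorus_iff hR, norm_sq_eq_coords]
  simp
  nlinarith [sq_nonneg s]

/-- The torus is invariant under the inversions in the spheres that are centred on its axis and
are orthogonal to it. -/
lemma inversion_image_roundTorus {R : ℝ} (hR : 1 < R) (s : ℝ) :
    EuclideanGeometry.inversion !₂[0, 0, s] √(s ^ 2 + (R ^ 2 - 1)) '' roundTorus R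
      = roundTorus R := by
  have hb : 0 < R ^ 2 - 1 := by nlinarith
  have hk : 0 < s ^ 2 + (R ^ 2 - 1) := by positivity
  refine image_eq_of_involutive
    (EuclideanGeometry.inversion_involutive _ (Real.sqrt_pos.2 hk).ne') fun x hx => ?_
  have hxc : x ≠ !₂[0, 0, s] := ne_of_mem_of_not_mem hx (axis_notMem_roundTorus hR s)
  rw [mem_roundTorus_iff hR, norm_sq_eq_coords] at hx ⊢
  have hd : (0 : ℝ) < dist x !₂[0, 0, s] ^ 2 := by
    have := dist_pos.2 hxc
    positivity
  have hd' : dist x !₂[0, 0, s] ^ 2 = x 0 ^ 2 + x 1 ^ 2 + (x 2 - s) ^ 2 := by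
    rw [dist_eq_norm, norm_sq_eq_coords]
    simp
  set m := (s ^ 2 + (R ^ 2 - 1)) / dist x !₂[0, 0, s] ^ 2 with hm
  have hmd : m * (x 0 ^ 2 + x 1 ^ 2 + (x 2 - s) ^ 2) = s ^ 2 + (R ^ 2 - 1) := by
    rw [← hd', hm, div_mul_cancel₀ _ hd.ne']
  have hJ : EuclideanGeometry.inversion !₂[0, 0, s] √(s ^ 2 + (R ^ 2 - 1)) x
      = !₂[m * x 0, m * x 1, m * (x 2 - s) + s] := by
    rw [EuclideanGeometry.inversion, div_pow, Real.sq_sqrt hk.le, ← hm]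
    apply ext_coords <;> simp
  rw [hJ]
  simp only [Matrix.cons_val_zero, Matrix.cons_val_one, Matrix.cons_val]
  -- The inversion multiplies `‖x‖ ^ 2 + (R ^ 2 - 1)` by the same factor `m` as `x 0` and `x 1`, and
  -- the torus equation is homogeneous in these three quantities.
  have e : (m * x 0) ^ 2 + (m * x 1) ^ 2 + (m * (x 2 - s) + s) ^ 2 + (R ^ 2 - 1)
      = m * (x 0 ^ 2 + x 1 ^ 2 + x 2 ^ 2 + (R ^ 2 - 1)) := by
    linear_combination (m - 1) * hmd
  rw [e, mul_pow, hx]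
  ring

/-! ### Centres on one profile torus give one shape -/

lemma mem_roundTorus_of_mem_profileTorus {R d : ℝ} (hR : 1 < R) (hd : 0 ≤ d)
    (hdb : d ^ 2 ≤ R ^ 2 - 1) {p : E3} (hp : p ∈ profileTorus R d) :
    p ∈ roundTorus R ↔ d = R - 1 := by
  have hb : 0 < R ^ 2 - 1 := by nlinarith
  obtain ⟨q, hq, θ, -, rfl⟩ := hp
  rw [mem_roundTorus_iff hR, norm_sq_eq_coords]
  simp only [Matrix.cons_val_zero, Matrix.cons_val_one, Matrix.cons_val]
  have h := Real.sin_sq_add_cos_sq θ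
  have e : (q.1 * Real.cos θ) ^ 2 + (q.1 * Real.sin θ) ^ 2 = q.1 ^ 2 := by
    linear_combination q.1 ^ 2 * h
  rw [e]
  rcases hq with ⟨rfl, hq⟩ | ⟨hd0, hq⟩
  · rw [hq]
    constructor
    · intro h; nlinarith [sq_nonneg q.2]
    · intro h; linarith
  · have hdpos : 0 < d := lt_of_le_of_ne hd (Ne.symm hd0)
    -- The ratio `(ρ ^ 2 + z ^ 2 + (R ^ 2 - 1)) / ρ` is constant on the profile circle; on the torus
    -- it is `2 * R`.
    have hc : d * (q.1 ^ 2 + q.2 ^ 2 + (R ^ 2 - 1)) = q.1 * (d ^ 2 + (R ^ 2 - 1)) := by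
      field_simp at hq
      apply mul_left_cancel₀ hd0
      linear_combination hq / 4
    have hq1 : 0 < q.1 := by
      have : 0 < q.1 * (d ^ 2 + (R ^ 2 - 1)) := by rw [← hc]; positivity
      exact pos_of_mul_pos_left this (by positivity)
    constructor
    · intro ht
      have ht' : q.1 ^ 2 + q.2 ^ 2 + (R ^ 2 - 1) = 2 * R * q.1 := by
        rw [← pow_left_inj₀ (by positivity) (by positivity) two_ne_zero, ht]
        ring
      rw [ht'] at hc
      have h1 : q.1 * ((d - R) ^ 2 - 1) = 0 := by linear_combination -hc
      have h2 : (d - (R - 1)) * (d - (R + 1)) = 0 := by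
        rcases mul_eq_zero.1 h1 with h | h
        · exact absurd h hq1.ne'
        · linear_combination h
      rcases mul_eq_zero.1 h2 with h | h
      · linarith
      · nlinarith
    · rintro rfl
      have h1 : q.1 ^ 2 + q.2 ^ 2 + (R ^ 2 - 1) = 2 * R * q.1 := by
        apply mul_left_cancel₀ hd0
        rw [hc]; ring
      rw [h1]; ring

lemma homothetic_invertedTorus_of_axis_inversion {R d ρ z : ℝ} (hR : 1 < R)
    (hp : !₂[ρ, 0, z] ∉ roundTorus R) (s : ℝ) (hD : ρ ^ 2 + (z - s) ^ 2 ≠ 0)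
    (h0 : (s ^ 2 + (R ^ 2 - 1)) * ρ = d * (ρ ^ 2 + (z - s) ^ 2))
    (h1 : (s ^ 2 + (R ^ 2 - 1)) * (z - s) + s * (ρ ^ 2 + (z - s) ^ 2) = 0) :
    Homothetic (invertedTorus R !₂[ρ, 0, z]) (invertedTorus R !₂[d, 0, 0]) := by
  have hb : 0 < R ^ 2 - 1 := by nlinarith
  have hk : 0 < s ^ 2 + (R ^ 2 - 1) := by positivity
  have hd : dist !₂[ρ, 0, z] !₂[0, 0, s] ^ 2 = ρ ^ 2 + (z - s) ^ 2 := by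
    rw [dist_eq_norm, norm_sq_eq_coords]
    simp
  have hpc : !₂[ρ, 0, z] ≠ !₂[0, 0, s] := by
    rw [← dist_pos]
    exact lt_of_le_of_ne dist_nonneg fun h => hD <| by rw [← hd, ← h]; simp
  have := homothetic_inversion_inversion (Real.sqrt_pos.2 hk).ne' hpc
    (axis_notMem_roundTorus hR s) hp (inversion_image_roundTorus hR s)
  have hJ : EuclideanGeometry.inversion !₂[0, 0, s] √(s ^ 2 + (R ^ 2 - 1)) !₂[ρ, 0, z]
      = !₂[d, 0, 0] := by
    rw [EuclideanGeometry.inversion, div_pow, Real.sq_sqrt hk.le, hd]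
    apply ext_coords
    · simp
      field_simp
      linarith
    · simp
    · simp
      field_simp
      linarith
  rwa [hJ] at this

lemma homothetic_invertedTorus_of_mem_profileTorus {R d : ℝ} (hR : 1 < R) (hd : 0 ≤ d)
    (hdb : d ^ 2 ≤ R ^ 2 - 1) (hdR : d ≠ R - 1) {p : E3} (hp : p ∈ profileTorus R d) :
    Homothetic (invertedTorus R p) (invertedTorus R !₂[d, 0, 0]) := by
  have hb : 0 < R ^ 2 - 1 := by nlinarith
  obtain ⟨⟨ρ, z⟩, hq, θ, -, rfl⟩ := hp
  have hmem : !₂[ρ, 0, z] ∈ profileTorus R d :=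
    ⟨(ρ, z), hq, 0, ⟨le_rfl, by positivity⟩, by simp⟩
  have hT : !₂[ρ, 0, z] ∉ roundTorus R := by
    rwa [mem_roundTorus_of_mem_profileTorus hR hd hdb hmem]
  have hrot := homothetic_inversion_map (verticalReflection θ) !₂[ρ, 0, z]
    (verticalReflection_image_roundTorus hR θ)
  have hv : verticalReflection θ !₂[ρ, 0, z] = !₂[ρ * Real.cos θ, ρ * Real.sin θ, z] := by
    rw [verticalReflection_apply]
    apply ext_coords <;> simp <;> ring
  rw [hv] at hrot
  refine hrot.symm.trans ?_
  rcases hq with ⟨rfl, hq⟩ | ⟨hd0, hq⟩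
  · simp only at hq
    subst hq
    by_cases hz : z = 0
    · rw [hz]; exact homothetySetoid.refl _
    have hzs : z - -(R ^ 2 - 1) / z = (z ^ 2 + (R ^ 2 - 1)) / z := by field_simp; ring
    have hzs' : z - -(R ^ 2 - 1) / z ≠ 0 := by rw [hzs]; positivity
    -- This centre makes the axis inversion send height `z` to the origin.
    refine homothetic_invertedTorus_of_axis_inversion hR hT (-(R ^ 2 - 1) / z) ?_ ?_ ?_
    · positivity
    · ring
    · field_simp
      ring
  · simp only at hq
    have hdpos : 0 < d := lt_of_le_of_ne hd (Ne.symm hd0)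
    have hc : d * (ρ ^ 2 + z ^ 2 + (R ^ 2 - 1)) = ρ * (d ^ 2 + (R ^ 2 - 1)) := by
      field_simp at hq
      apply mul_left_cancel₀ hd0
      linear_combination hq / 4
    have hρ : 0 < ρ := by
      have : 0 < ρ * (d ^ 2 + (R ^ 2 - 1)) := by rw [← hc]; positivity
      exact pos_of_mul_pos_left this (by positivity)
    by_cases hρd : ρ = d
    · subst hρd
      have : ρ * z ^ 2 = 0 := by linear_combination hc
      have hz : z = 0 := by simpa [hd0] using this
      rw [hz]; exact homothetySetoid.refl _
    have hdρ : d - ρ ≠ 0 := fun h => hρd (by linarith)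
    -- A point, its image and the centre of inversion are collinear: the centre is where the line
    -- through `(ρ, z)` and `(d, 0)` meets the axis.
    refine homothetic_invertedTorus_of_axis_inversion hR hT (d * z / (d - ρ)) (by positivity) ?_ ?_
    · field_simp
      linear_combination (d - ρ) * ρ * hc
    · field_simp
      linear_combination (-z * ρ * (d - ρ)) * hc

/-- Off the axis, `d` is the smaller root of `d ^ 2 - 2 * m * d + (R ^ 2 - 1) = 0`; the roots are
real because `m ^ 2 ≥ R ^ 2 - 1`, and their product is `R ^ 2 - 1`. -/
lemma exists_mem_profileTorus {R : ℝ} (hR : 1 < R) (p : E3) :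
    ∃ d, 0 ≤ d ∧ d ^ 2 ≤ R ^ 2 - 1 ∧ p ∈ profileTorus R d := by
  have hb : 0 < R ^ 2 - 1 := by nlinarith
  obtain ⟨u, hu, hu0, hu1⟩ := exists_polar (p 0) (p 1)
  set ρ := √(p 0 ^ 2 + p 1 ^ 2)
  have hρ0 : 0 ≤ ρ := Real.sqrt_nonneg _
  have hp : p = !₂[ρ * Real.cos u, ρ * Real.sin u, p 2] := by
    apply ext_coords
    · simpa using hu0
    · simpa using hu1
    · simp
  rcases hρ0.eq_or_lt with h | hρ
  · exact ⟨0, le_rfl, by simpa using hb.le, (ρ, p 2), Or.inl ⟨rfl, h.symm⟩, u, hu, hp⟩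
  set m := (ρ ^ 2 + p 2 ^ 2 + (R ^ 2 - 1)) / (2 * ρ) with hm
  have hm0 : 0 < m := by positivity
  have hmρ : 2 * ρ * m = ρ ^ 2 + p 2 ^ 2 + (R ^ 2 - 1) := by rw [hm]; field_simp
  have hmb : R ^ 2 - 1 ≤ m ^ 2 := by
    have h1 : 4 * ρ ^ 2 * (R ^ 2 - 1) ≤ 4 * ρ ^ 2 * m ^ 2 := by
      have : 4 * ρ ^ 2 * m ^ 2 = (ρ ^ 2 + p 2 ^ 2 + (R ^ 2 - 1)) ^ 2 := by rw [← hmρ]; ring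
      rw [this]
      nlinarith [sq_nonneg (ρ ^ 2 - (R ^ 2 - 1)), sq_nonneg (p 2), sq_nonneg (p 2 ^ 2),
        mul_nonneg (sq_nonneg (p 2)) (sq_nonneg ρ), mul_nonneg (sq_nonneg (p 2)) hb.le]
    exact le_of_mul_le_mul_left h1 (by positivity)
  set e := √(m ^ 2 - (R ^ 2 - 1)) with he
  have he0 : 0 ≤ e := Real.sqrt_nonneg _
  have he2 : e ^ 2 = m ^ 2 - (R ^ 2 - 1) := Real.sq_sqrt (by linarith)
  have hd : (m - e) * (m + e) = R ^ 2 - 1 := by linear_combination -he2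
  have hd0 : 0 < m - e := by
    have : 0 < (m - e) * (m + e) := by rw [hd]; exact hb
    exact pos_of_mul_pos_left this (by positivity)
  refine ⟨m - e, hd0.le, by nlinarith, (ρ, p 2), Or.inr ⟨hd0.ne', ?_⟩, u, hu, hp⟩
  have h1 : (R ^ 2 - 1) / (m - e) = m + e := by rw [← hd]; field_simp
  simp only
  rw [h1]
  linear_combination -he2 - hmρ

/-! ### Normal forms of inverted tori -/

lemma mem_invertedTorus_iff {R d : ℝ} (hR : 1 < R) (hp : !₂[d, 0, 0] ∉ roundTorus R) (X Y Z : ℝ) :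
    !₂[d + X, Y, Z] ∈ invertedTorus R !₂[d, 0, 0] ↔
      ((d ^ 2 + (R ^ 2 - 1)) * (X ^ 2 + Y ^ 2 + Z ^ 2) + 2 * d * X + 1) ^ 2
        = 4 * R ^ 2 * ((d * (X ^ 2 + Y ^ 2 + Z ^ 2) + X) ^ 2 + Y ^ 2) := by
  have hinv := EuclideanGeometry.inversion_involutive (!₂[d, 0, 0] : E3) one_ne_zero
  have h1 : !₂[d + X, Y, Z] ∈ invertedTorus R !₂[d, 0, 0] ↔
      EuclideanGeometry.inversion !₂[d, 0, 0] 1 !₂[d + X, Y, Z] ∈ roundTorus R := by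
    constructor
    · rintro ⟨x, hx, h⟩
      rw [← h, hinv]
      exact hx
    · intro h
      exact ⟨_, h, hinv _⟩
  rw [h1]
  have hn : ‖(!₂[d + X, Y, Z] - !₂[d, 0, 0] : E3)‖ ^ 2 = X ^ 2 + Y ^ 2 + Z ^ 2 := by
    rw [norm_sq_eq_coords]; simp
  -- The inversion fixes its own centre by convention. The centre is off the torus, and there the
  -- quartic reads `1 = 0`.
  by_cases hN : X ^ 2 + Y ^ 2 + Z ^ 2 = 0
  · have hX : X = 0 := by nlinarith [sq_nonneg X, sq_nonneg Y, sq_nonneg Z]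
    have hY : Y = 0 := by nlinarith [sq_nonneg X, sq_nonneg Y, sq_nonneg Z]
    have hZ : Z = 0 := by nlinarith [sq_nonneg X, sq_nonneg Y, sq_nonneg Z]
    subst hX hY hZ
    simp [hp]
  · set N := X ^ 2 + Y ^ 2 + Z ^ 2 with hNdef
    have hJ : EuclideanGeometry.inversion !₂[d, 0, 0] 1 !₂[d + X, Y, Z]
        = !₂[d + N⁻¹ * X, N⁻¹ * Y, N⁻¹ * Z] := by
      rw [inversion_one_eq, hn]
      apply ext_coords <;> simp
      ring
    rw [hJ, mem_roundTorus_iff hR, norm_sq_eq_coords]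
    simp only [Matrix.cons_val_zero, Matrix.cons_val_one, Matrix.cons_val]
    have e1 : (d + N⁻¹ * X) ^ 2 + (N⁻¹ * Y) ^ 2 + (N⁻¹ * Z) ^ 2 + (R ^ 2 - 1)
        = ((d ^ 2 + (R ^ 2 - 1)) * N + 2 * d * X + 1) / N := by
      field_simp
      rw [hNdef]
      ring
    have e2 : (d + N⁻¹ * X) ^ 2 + (N⁻¹ * Y) ^ 2 = ((d * N + X) ^ 2 + Y ^ 2) / N ^ 2 := by
      field_simp
    rw [e1, e2, div_pow, ← mul_div_assoc, div_left_inj' (pow_ne_zero 2 hN)]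

lemma notMem_roundTorus_of_ne {R d : ℝ} (hR : 1 < R) (hd : 0 ≤ d)
    (hdb : d ^ 2 ≤ R ^ 2 - 1) (hdR : d ≠ R - 1) : !₂[d, 0, 0] ∉ roundTorus R := by
  have : !₂[d, 0, 0] ∈ profileTorus R d := by
    refine ⟨(d, 0), ?_, 0, ⟨le_rfl, by positivity⟩, by simp⟩
    by_cases h : d = 0
    · exact Or.inl ⟨h, h⟩
    · exact Or.inr ⟨h, by simp only; ring⟩
  rwa [mem_roundTorus_of_mem_profileTorus hR hd hdb this]

/-- The inverted torus has normal form `dupinCyclide r q`. -/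
def HasNormalForm (R d r q : ℝ) : Prop :=
  NestedCircles r q ∧ Homothetic (invertedTorus R !₂[d, 0, 0]) (dupinCyclide r q)

/-- The plane `z = 0` cuts the torus in circles of radii `R ± 1` about the origin, both enclosing
the centre of inversion. The smaller one becomes the outer circle and is scaled to radius 1; the
negative ratio puts the other centre on the nonnegative half-axis. -/
lemma hasNormalForm_outside {R d : ℝ} (hR : 1 < R) (hd : 0 ≤ d) (hdR : d < R - 1) :
    HasNormalForm R d ((R + 1) * ((R - 1) ^ 2 - d ^ 2) / ((R - 1) * ((R + 1) ^ 2 - d ^ 2)))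
      (4 * R * d / ((R - 1) * ((R + 1) ^ 2 - d ^ 2))) := by
  have hR1 : 0 < R - 1 := by linarith
  have hα : 0 < (R - 1) ^ 2 - d ^ 2 := by nlinarith
  have hβ : 0 < (R + 1) ^ 2 - d ^ 2 := by nlinarith
  have hp := notMem_roundTorus_of_ne hR hd (by nlinarith) hdR.ne
  refine ⟨⟨by positivity, by positivity, ?_⟩, ?_⟩
  · rw [← add_div, div_lt_one (by positivity)]
    nlinarith [mul_pos (sub_pos.2 hdR) (by linarith : 0 < R + 1 - d)]
  refine Homothetic.symm <| homothetic_of_mem_iff (LinearIsometryEquiv.refl ℝ E3)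
    !₂[d + d / ((R - 1) ^ 2 - d ^ 2), 0, 0] (t := -((R - 1) / ((R - 1) ^ 2 - d ^ 2)))
    (neg_ne_zero.2 (by positivity)) fun x => ?_
  have hw : !₂[d + d / ((R - 1) ^ 2 - d ^ 2), 0, 0] + (-((R - 1) / ((R - 1) ^ 2 - d ^ 2))) •
      (LinearIsometryEquiv.refl ℝ E3) x = !₂[d + (d - (R - 1) * x 0) / ((R - 1) ^ 2 - d ^ 2),
        -((R - 1) * x 1) / ((R - 1) ^ 2 - d ^ 2), -((R - 1) * x 2) / ((R - 1) ^ 2 - d ^ 2)] := by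
    apply ext_coords <;> simp <;> ring
  rw [hw, mem_invertedTorus_iff hR hp, mem_dupinCyclide, norm_sq_eq_coords,
    ← sub_eq_zero (b := 4 * _ * _)]
  set α := (R - 1) ^ 2 - d ^ 2 with hαd
  set β := (R + 1) ^ 2 - d ^ 2 with hβd
  -- The two quartics are proportional, with this constant factor.
  have hκ : (R - 1) ^ 4 * β / α ^ 3 ≠ 0 := by positivity
  rw [← mul_eq_zero_iff_left hκ]
  refine Eq.congr ?_ rfl
  field_simp
  rw [hαd, hβd]
  ring

/-- Here the useful section is `y = 0`, two unit circles centred at `(±R, 0)`. The one enclosing the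
centre of inversion becomes the outer circle; exchanging the `y` and `z` coordinates brings this
plane to `z = 0`. -/
lemma hasNormalForm_inside {R d : ℝ} (hR : 1 < R) (hd : R - 1 < d) (hdb : d ^ 2 ≤ R ^ 2 - 1) :
    HasNormalForm R d ((1 - (d - R) ^ 2) / ((R + d) ^ 2 - 1))
      (2 * R * ((R ^ 2 - 1) - d ^ 2) / ((R + d) ^ 2 - 1)) := by
  have hdR : d < R + 1 := by nlinarith
  have hα : 0 < 1 - (d - R) ^ 2 := by nlinarith
  have hβ : 0 < (R + d) ^ 2 - 1 := by nlinarith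
  have hp := notMem_roundTorus_of_ne hR (by linarith) hdb hd.ne'
  refine ⟨⟨by positivity, div_nonneg (mul_nonneg (by linarith) (by linarith)) hβ.le, ?_⟩, ?_⟩
  · rw [← add_div, div_lt_one (by positivity)]
    nlinarith [mul_pos (mul_pos (sub_pos.2 hd) (by linarith : 0 < d + (R - 1)))
      (by linarith : 0 < R + 1)]
  let L : E3 ≃ₗᵢ[ℝ] E3 := LinearIsometryEquiv.piLpCongrLeft 2 ℝ ℝ (Equiv.swap (1 : Fin 3) 2)
  refine Homothetic.symm <| homothetic_of_mem_iff L
    !₂[d + (d - R) / (1 - (d - R) ^ 2), 0, 0] (t := 1 / (1 - (d - R) ^ 2))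
    (by positivity) fun x => ?_
  have hL : L x = !₂[x 0, x 2, x 1] := by
    apply ext_coords <;> simp [L, LinearIsometryEquiv.piLpCongrLeft_apply, Equiv.piCongrLeft'_apply,
      Equiv.swap_apply_of_ne_of_ne]
  have hw : !₂[d + (d - R) / (1 - (d - R) ^ 2), 0, 0] + (1 / (1 - (d - R) ^ 2)) • L x
      = !₂[d + (d - R + x 0) / (1 - (d - R) ^ 2), x 2 / (1 - (d - R) ^ 2),
        x 1 / (1 - (d - R) ^ 2)] := by
    rw [hL]
    apply ext_coords <;> simp <;> ring
  rw [hw, mem_invertedTorus_iff hR hp, mem_dupinCyclide, norm_sq_eq_coords,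
    ← sub_eq_zero (b := 4 * _ * _)]
  set α := 1 - (d - R) ^ 2 with hαd
  set β := (R + d) ^ 2 - 1 with hβd
  have hκ : -(β / α ^ 3) ≠ 0 := neg_ne_zero.2 (by positivity)
  rw [← mul_eq_zero_iff_left hκ]
  refine Eq.congr ?_ rfl
  field_simp
  rw [hαd, hβd]
  ring

/-- On each side, the second equation involves only `R` and the invariants, and so recovers `R`; the
first then recovers `d` from `r`. -/
lemma exists_normalForm {R d : ℝ} (hR : 1 < R) (hd : 0 ≤ d) (hdb : d ^ 2 ≤ R ^ 2 - 1)
    (hdR : d ≠ R - 1) : ∃ r q, HasNormalForm R d r q ∧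
      ((d < R - 1 ∧ r * ((R - 1) * ((R + 1) ^ 2 - d ^ 2)) = (R + 1) * ((R - 1) ^ 2 - d ^ 2) ∧
          ((1 + r) ^ 2 - q ^ 2) * (R ^ 2 - 1) = 4 * r * R ^ 2) ∨
        (R - 1 < d ∧ r * ((R + d) ^ 2 - 1) = 1 - (d - R) ^ 2 ∧
          (1 + r) ^ 2 - q ^ 2 = 4 * r * R ^ 2)) := by
  rcases hdR.lt_or_gt with h | h
  · refine ⟨_, _, hasNormalForm_outside hR hd h, Or.inl ⟨h, ?_, ?_⟩⟩
    · have h1 : 0 < R - 1 := by linarith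
      have h2 : 0 < (R + 1) ^ 2 - d ^ 2 := by nlinarith
      field_simp
    · have h1 : 0 < R - 1 := by linarith
      have h2 : 0 < (R + 1) ^ 2 - d ^ 2 := by nlinarith
      field_simp
      ring
  · have h2 : 0 < (R + d) ^ 2 - 1 := by nlinarith
    refine ⟨_, _, hasNormalForm_inside hR h hdb, Or.inr ⟨h, ?_, ?_⟩⟩
    · field_simp
    · field_simp
      ring

lemma HasNormalForm.congr {R d r q r' q' : ℝ} (h : HasNormalForm R d r' q') (hr : r' = r)
    (hq : 0 ≤ q) (hqq : q' ^ 2 = q ^ 2) : HasNormalForm R d r q := by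
  have : q' = q := (pow_left_inj₀ h.1.2.1 hq two_ne_zero).1 hqq
  rwa [← hr, ← this]

lemma exists_inside_of_nestedCircles {R r q : ℝ} (hR : 1 < R) (h : NestedCircles r q)
    (hK : (1 + r) ^ 2 - q ^ 2 = 4 * r * R ^ 2) :
    ∃ d, R - 1 < d ∧ d ^ 2 ≤ R ^ 2 - 1 ∧ HasNormalForm R d r q := by
  obtain ⟨hr, hq, hrq⟩ := h
  have hb : 0 < R ^ 2 - 1 := by nlinarith
  -- Solving the formula for `r` gives `d ^ 2 - 2 * m * d + (R ^ 2 - 1) = 0`; its discriminant is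
  -- nonnegative because `hK` turns it into a multiple of `q ^ 2`.
  set m := R * (1 - r) / (1 + r) with hm
  have hmr : m * (1 + r) = R * (1 - r) := by rw [hm]; field_simp
  have hm0 : 0 < m := by
    have : 0 < 1 - r := by linarith
    positivity
  have hmb : R ^ 2 - 1 ≤ m ^ 2 := by
    have h1 : (1 + r) ^ 2 * (R ^ 2 - 1) ≤ (1 + r) ^ 2 * m ^ 2 := by
      have : (1 + r) ^ 2 * m ^ 2 = (R * (1 - r)) ^ 2 := by rw [← hmr]; ring
      rw [this]
      nlinarith [sq_nonneg q]
    exact le_of_mul_le_mul_left h1 (by positivity)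
  set e := √(m ^ 2 - (R ^ 2 - 1)) with he
  have he0 : 0 ≤ e := Real.sqrt_nonneg _
  have he2 : e ^ 2 = m ^ 2 - (R ^ 2 - 1) := Real.sq_sqrt (by linarith)
  have hd : (m - e) * (m + e) = R ^ 2 - 1 := by linear_combination -he2
  have hd0 : 0 < m - e := by
    have : 0 < (m - e) * (m + e) := by rw [hd]; exact hb
    exact pos_of_mul_pos_left this (by positivity)
  have hdb : (m - e) ^ 2 ≤ R ^ 2 - 1 := by nlinarith
  have hβ : 0 < (R + (m - e)) ^ 2 - 1 := by nlinarith
  have hrd : r * ((R + (m - e)) ^ 2 - 1) = 1 - ((m - e) - R) ^ 2 := by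
    linear_combination (1 + r) * he2 + 2 * (m - e) * hmr
  have hα : 0 < 1 - ((m - e) - R) ^ 2 := by rw [← hrd]; positivity
  have hdR : R - 1 < m - e := by nlinarith
  have hr' : (1 - ((m - e) - R) ^ 2) / ((R + (m - e)) ^ 2 - 1) = r := by
    rw [← hrd]; field_simp
  refine ⟨m - e, hdR, hdb, ?_⟩
  obtain ⟨r', q', hN, ⟨h, -⟩ | ⟨-, h1, h2⟩⟩ := exists_normalForm hR hd0.le hdb hdR.ne'
  · exact absurd h hdR.not_gt
  · have hrr : r' = r := mul_right_cancel₀ hβ.ne' (h1.trans hrd.symm)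
    exact hN.congr hrr hq (by rw [hrr] at h2; linarith)

lemma exists_outside_of_nestedCircles {R r q : ℝ} (hR : 1 < R) (h : NestedCircles r q)
    (hK : ((1 + r) ^ 2 - q ^ 2) * (R ^ 2 - 1) = 4 * r * R ^ 2) :
    ∃ d, 0 ≤ d ∧ d < R - 1 ∧ HasNormalForm R d r q := by
  obtain ⟨hr, hq, hrq⟩ := h
  have hR1 : 0 < R - 1 := by linarith
  have hb : 0 < R ^ 2 - 1 := by nlinarith
  have hc : 0 < (R + 1) - r * (R - 1) := by nlinarith
  have hr0 : r * (R + 1) ≤ R - 1 := by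
    have h1 : 0 ≤ (R - 1 - r * (R + 1)) * ((R + 1) - r * (R - 1)) := by
      have : (R - 1 - r * (R + 1)) * ((R + 1) - r * (R - 1)) = q ^ 2 * (R ^ 2 - 1) := by
        linear_combination hK
      rw [this]; positivity
    have := nonneg_of_mul_nonneg_left h1 hc
    linarith
  -- The value of `(R + 1) ^ 2 - d ^ 2` forced by the formula for `r`.
  set β := 4 * R * (R + 1) / ((R + 1) - r * (R - 1)) with hβ
  have hβr : β * ((R + 1) - r * (R - 1)) = 4 * R * (R + 1) := by rw [hβ]; field_simp
  have hβ0 : 0 < β := by positivity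
  have hβle : β ≤ (R + 1) ^ 2 := by
    rw [hβ, div_le_iff₀ hc]
    nlinarith [mul_nonneg (by positivity : 0 ≤ (R + 1) * (R - 1)) (sub_nonneg.2 hr0)]
  have hβlt : 4 * R < β := by
    rw [hβ, lt_div_iff₀ hc]
    have : 0 < 4 * R * (r * (R - 1)) := by positivity
    linarith
  set d := √((R + 1) ^ 2 - β) with hd
  have hd0 : 0 ≤ d := Real.sqrt_nonneg _
  have hd2 : d ^ 2 = (R + 1) ^ 2 - β := Real.sq_sqrt (by linarith)
  have hdR : d < R - 1 := by
    rw [← pow_lt_pow_iff_left₀ hd0 hR1.le two_ne_zero, hd2]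
    linarith
  have hrd : r * ((R - 1) * ((R + 1) ^ 2 - d ^ 2)) = (R + 1) * ((R - 1) ^ 2 - d ^ 2) := by
    rw [hd2]
    linear_combination -hβr
  refine ⟨d, hd0, hdR, ?_⟩
  obtain ⟨r', q', hN, ⟨-, h1, h2⟩ | ⟨h, -⟩⟩ := exists_normalForm hR hd0 (by nlinarith) hdR.ne
  · have hγ : (R - 1) * ((R + 1) ^ 2 - d ^ 2) ≠ 0 := by
      rw [hd2]
      exact mul_ne_zero hR1.ne' (by linarith)
    have hrr : r' = r := mul_right_cancel₀ hγ (h1.trans hrd.symm)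
    refine hN.congr hrr hq (mul_right_cancel₀ hb.ne' ?_)
    rw [hrr] at h2
    linarith
  · exact absurd h hdR.not_gt

/-! ### Injectivity and surjectivity on the parameter set -/

lemma mem_paramSet_iff {R d : ℝ} : (R, d) ∈ paramSet ↔
    1 < R ∧ R ^ 2 ≤ 2 ∧ 0 ≤ d ∧ d ^ 2 ≤ R ^ 2 - 1 ∧ d ≠ R - 1 ∧ (R ^ 2 = 2 → d < R - 1) := by
  have h2 : √2 ^ 2 = (2 : ℝ) := Real.sq_sqrt (by norm_num)
  have h0 : 0 ≤ √(2 : ℝ) := Real.sqrt_nonneg _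
  have hmem : (R, d) ∈ paramSet ↔ (1 < R ∧ R ≤ √2) ∧ d ∈ paramFiber R := by
    simp [paramSet]
  rw [hmem]
  constructor
  · rintro ⟨⟨hR, hR2⟩, h⟩
    have hb : 0 ≤ R ^ 2 - 1 := by nlinarith
    refine ⟨hR, (Real.le_sqrt (by linarith) (by norm_num)).1 hR2, ?_⟩
    rcases h with ⟨hlt, ⟨hd0, hd⟩, hne⟩ | ⟨rfl, hd0, hd⟩
    · refine ⟨hd0, (Real.le_sqrt hd0 hb).1 hd, hne, fun h => ?_⟩
      have : R ^ 2 < 2 := (Real.lt_sqrt (by linarith)).1 hlt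
      linarith
    · exact ⟨hd0, by nlinarith, hd.ne, fun _ => hd⟩
  · rintro ⟨hR, hR2, hd0, hd, hne, himp⟩
    refine ⟨⟨hR, (Real.le_sqrt (by linarith) (by norm_num)).2 hR2⟩, ?_⟩
    rcases hR2.lt_or_eq with hlt | heq
    · exact Or.inl ⟨(Real.lt_sqrt (by linarith)).2 hlt, ⟨hd0, Real.le_sqrt_of_sq_le hd⟩, hne⟩
    · have hRe : R = √2 := by rw [← heq, Real.sqrt_sq (by linarith)]
      exact Or.inr ⟨hRe, hd0, hRe ▸ himp heq⟩

lemma shapeOf_eq_iff {S T : Set E3} : shapeOf S = shapeOf T ↔ Homothetic S T := Quotient.eq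

lemma eq_of_homothetic_invertedTorus {R d R' d' : ℝ} (h : (R, d) ∈ paramSet)
    (h' : (R', d') ∈ paramSet)
    (hh : Homothetic (invertedTorus R !₂[d, 0, 0]) (invertedTorus R' !₂[d', 0, 0])) :
    (R, d) = (R', d') := by
  obtain ⟨hR, hR2, hd0, hdb, hne, himp⟩ := mem_paramSet_iff.1 h
  obtain ⟨hR', hR2', hd0', hdb', hne', himp'⟩ := mem_paramSet_iff.1 h'
  obtain ⟨r, q, ⟨hN, hH⟩, hc⟩ := exists_normalForm hR hd0 hdb hne
  obtain ⟨r', q', ⟨hN', hH'⟩, hc'⟩ := exists_normalForm hR' hd0' hdb' hne'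
  obtain ⟨rfl, rfl⟩ := eq_of_homothetic_dupinCyclide hN hN' (hH.symm.trans (hh.trans hH'))
  have hr := hN.1
  have hb : 0 < R ^ 2 - 1 := by nlinarith
  have hb' : 0 < R' ^ 2 - 1 := by nlinarith
  have hinj : R ^ 2 = R' ^ 2 → R = R' := (pow_left_inj₀ (by linarith) (by linarith) two_ne_zero).1
  -- An outside and an inside centre share their invariants only if `1 / A ^ 2 + 1 / B ^ 2 = 1`,
  -- which under these bounds forces the self-dual value 2, where the parameter set has no inside
  -- centres.
  have mixed : ∀ {A B : ℝ}, A ^ 2 ≤ 2 → B ^ 2 ≤ 2 → 0 < A ^ 2 - 1 →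
      ((1 + r) ^ 2 - q ^ 2) * (A ^ 2 - 1) = 4 * r * A ^ 2 →
      (1 + r) ^ 2 - q ^ 2 = 4 * r * B ^ 2 → B ^ 2 = 2 := by
    intro A B hA hB hA1 h1 h2
    rw [h2] at h1
    have h3 : r * (B ^ 2 * (A ^ 2 - 1) - A ^ 2) = 0 := by linarith
    have h4 : B ^ 2 * (A ^ 2 - 1) - A ^ 2 = 0 := by simpa [hr.ne'] using h3
    nlinarith
  rcases hc with ⟨hd, e1, e2⟩ | ⟨hd, e1, e2⟩ <;> rcases hc' with ⟨hd', e1', e2'⟩ | ⟨hd', e1', e2'⟩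
  · have hRR : R = R' := by
      apply hinj
      have h1 : 4 * r * (R ^ 2 - R' ^ 2) = 0 := by
        linear_combination (R' ^ 2 - 1) * e2 - (R ^ 2 - 1) * e2'
      have : R ^ 2 - R' ^ 2 = 0 := by simpa [hr.ne'] using h1
      linarith
    subst hRR
    have h1 : ((R + 1) - r * (R - 1)) * (d ^ 2 - d' ^ 2) = 0 := by linear_combination e1 - e1'
    have hpos : 0 < (R + 1) - r * (R - 1) := by nlinarith [hN.2.1, hN.2.2]
    have h2 : d ^ 2 - d' ^ 2 = 0 := by simpa [hpos.ne'] using h1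
    rw [(pow_left_inj₀ hd0 hd0' two_ne_zero).1 (by linarith : d ^ 2 = d' ^ 2)]
  · exact absurd (himp' (mixed hR2 hR2' hb e2 e2')) hd'.not_gt
  · exact absurd (himp (mixed hR2' hR2 hb' e2' e2)) hd.not_gt
  · have hRR : R = R' := by
      apply hinj
      have h1 : 4 * r * (R ^ 2 - R' ^ 2) = 0 := by linear_combination e2' - e2
      have : R ^ 2 - R' ^ 2 = 0 := by simpa [hr.ne'] using h1
      linarith
    subst hRR
    have h1 : (1 + r) * ((d - d') * (d * d' - (R ^ 2 - 1))) = 0 := by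
      linear_combination d' * e1 - d * e1'
    have h2 : (d - d') * (d * d' - (R ^ 2 - 1)) = 0 := by
      simpa [(by linarith : 1 + r ≠ 0)] using h1
    have hdd : d = d' := by
      rcases mul_eq_zero.1 h2 with h | h
      · linarith
      -- The other root satisfies `d * d' = R ^ 2 - 1`; as both squares are at most `R ^ 2 - 1`, the
      -- roots coincide.
      · have h3 : (d - d') ^ 2 ≤ 0 := by
          have : (d - d') ^ 2 = d ^ 2 + d' ^ 2 - 2 * (d * d') := by ring
          linarith
        exact sub_eq_zero.1 (pow_eq_zero_iff two_ne_zero |>.1 (le_antisymm h3 (sq_nonneg _)))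
    rw [hdd]

lemma inversionShape_eq_of_hasNormalForm {R d R' d' r q : ℝ} (h : HasNormalForm R d r q)
    (h' : HasNormalForm R' d' r q) : inversionShape R d = inversionShape R' d' :=
  shapeOf_eq_iff.2 (h.2.trans h'.2.symm)

lemma exists_mem_paramSet_inversionShape_eq {R d : ℝ} (hR : 1 < R) (hd : 0 ≤ d)
    (hdb : d ^ 2 ≤ R ^ 2 - 1) (hdR : d ≠ R - 1) :
    ∃ c ∈ paramSet, inversionShape c.1 c.2 = inversionShape R d := by
  by_cases hmem : (R, d) ∈ paramSet
  · exact ⟨_, hmem, rfl⟩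
  have hb : 0 < R ^ 2 - 1 := by nlinarith
  have hR2 : 2 ≤ R ^ 2 := by
    by_contra! hlt
    exact hmem (mem_paramSet_iff.2 ⟨hR, hlt.le, hd, hdb, hdR, fun h => absurd h hlt.ne⟩)
  -- The dual torus, conformally equivalent to the given one with its two sides exchanged.
  set S := √(R ^ 2 / (R ^ 2 - 1)) with hS
  have hS2 : S ^ 2 = R ^ 2 / (R ^ 2 - 1) := Real.sq_sqrt (by positivity)
  have hSR : S ^ 2 * (R ^ 2 - 1) = R ^ 2 := by rw [hS2]; field_simp
  have hS1 : 1 < S := by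
    rw [hS, Real.lt_sqrt (by norm_num), lt_div_iff₀ hb]
    linarith
  have hSle : S ^ 2 ≤ 2 := by
    rw [hS2, div_le_iff₀ hb]
    linarith
  obtain ⟨r, q, hN, ⟨hd', -, hK⟩ | ⟨hd', -, hK⟩⟩ := exists_normalForm hR hd hdb hdR
  · have hR2' : 2 < R ^ 2 := by
      refine lt_of_le_of_ne hR2 fun h => hmem ?_
      exact mem_paramSet_iff.2 ⟨hR, h.symm.le, hd, hdb, hdR, fun _ => hd'⟩
    have hSlt : S ^ 2 < 2 := by
      rw [hS2, div_lt_iff₀ hb]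
      linarith
    obtain ⟨e, he, heb, hM⟩ := exists_inside_of_nestedCircles hS1 hN.1
      (mul_right_cancel₀ hb.ne' (by rw [hK]; linear_combination (-4 * r) * hSR))
    exact ⟨(S, e), mem_paramSet_iff.2 ⟨hS1, hSle, by linarith, heb, he.ne',
      fun h => absurd h hSlt.ne⟩, inversionShape_eq_of_hasNormalForm hM hN⟩
  · obtain ⟨e, he0, he, hM⟩ := exists_outside_of_nestedCircles hS1 hN.1
      (by rw [hK]; linear_combination (4 * r) * hSR)
    exact ⟨(S, e), mem_paramSet_iff.2 ⟨hS1, hSle, he0, by nlinarith, he.ne,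
      fun _ => he⟩, inversionShape_eq_of_hasNormalForm hM hN⟩

end

/-- The shape `i_ϱ(T_R)` is well defined on `C` (every centre on `profileTorus R ϱ` gives it),
distinct elements of `C` give distinct shapes, and `(R, ϱ) ↦ i_ϱ(T_R)` is a one-to-one
correspondence of `C` with the whole shape space. -/
theorem mainTheorem7 :
    (∀ R ϱ : ℝ, (R, ϱ) ∈ paramSet → ∀ p ∈ profileTorus R ϱ,
      p ∉ roundTorus R ∧ shapeOf (invertedTorus R p) = inversionShape R ϱ) ∧
    (∀ R ϱ R' ϱ' : ℝ, (R, ϱ) ∈ paramSet → (R', ϱ') ∈ paramSet → (R, ϱ) ≠ (R', ϱ') →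
      ∀ p ∈ profileTorus R ϱ, ∀ p' ∈ profileTorus R' ϱ',
        ¬ Homothetic (invertedTorus R p) (invertedTorus R' p')) ∧
    Set.BijOn (fun c : ℝ × ℝ => inversionShape c.1 c.2) paramSet shapeSpace := by
  have toAxis : ∀ {R ϱ : ℝ}, (R, ϱ) ∈ paramSet → ∀ {p}, p ∈ profileTorus R ϱ →
      Homothetic (invertedTorus R p) (invertedTorus R !₂[ϱ, 0, 0]) := fun h _ hp => by
    obtain ⟨hR, -, hd0, hdb, hne, -⟩ := mem_paramSet_iff.1 h
    exact homothetic_invertedTorus_of_mem_profileTorus hR hd0 hdb hne hp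
  refine ⟨fun R ϱ h p hp => ⟨?_, shapeOf_eq_iff.2 (toAxis h hp)⟩,
    fun R ϱ R' ϱ' h h' hne p hp p' hp' hh => hne ?_, ?_, ?_, ?_⟩
  · obtain ⟨hR, -, hd0, hdb, hne, -⟩ := mem_paramSet_iff.1 h
    rwa [mem_roundTorus_of_mem_profileTorus hR hd0 hdb hp]
  · exact eq_of_homothetic_invertedTorus h h' ((toAxis h hp).symm.trans (hh.trans (toAxis h' hp')))
  · rintro ⟨R, ϱ⟩ h
    obtain ⟨hR, -, hd0, hdb, hne, -⟩ := mem_paramSet_iff.1 h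
    exact ⟨R, hR, _, notMem_roundTorus_of_ne hR hd0 hdb hne, rfl⟩
  · rintro ⟨R, ϱ⟩ h ⟨R', ϱ'⟩ h' heq
    exact eq_of_homothetic_invertedTorus h h' (shapeOf_eq_iff.1 heq)
  · rintro _ ⟨R, hR, p, hp, rfl⟩
    obtain ⟨ϱ, hd0, hdb, hmem⟩ := exists_mem_profileTorus hR p
    have hne : ϱ ≠ R - 1 := fun h =>
      hp ((mem_roundTorus_of_mem_profileTorus hR hd0 hdb hmem).2 h)
    obtain ⟨c, hc, hcs⟩ := exists_mem_paramSet_inversionShape_eq hR hd0 hdb hne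
    exact ⟨c, hc, hcs.trans (shapeOf_eq_iff.2
      (homothetic_invertedTorus_of_mem_profileTorus hR hd0 hdb hne hmem)).symm⟩
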